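/- Let $G$ be a finite-dimensional real Lie group with Lie algebra $\mathfrak g$, and let $\lambda_a(g)=ag$ denote left translation. On $TG\setminus\{0\}$ let $S$ be the canonical spray of $G$: in the left trivialization $TG\cong G\times\mathfrak g$ it is $S_{(x,\alpha)}=(\lambda_{x})_*\alpha\,\frac{\partial}{\partial x}$, so its geodesics (the regular curves $\gamma$ on open intervals such that $\dot\gamma$ is an integral curve of $S$) are the left translates of one-parameter subgroups. A function $L$ on $TG$ is left invariant if $L\circ(\lambda_a)_*=L$ for all $a\in G$. A Finsler metric on $G$ is a function $F\colon TG\to\mathbb R$ that is positive and smooth on $TG\setminus\{0\}$, positively homogeneous of degree $1$ on each fibre, and such that the fibre Hessian of $F^2/2$ is positive definite on $TG\setminus\{0\}$; its energy is $E=F^2/2$. The energy of a Riemannian metric $g$ is $E(v)=\frac12 g(v,v)$. A Riemannian metric is left invariant if every $\lambda_a$ is an isometry of it. The geodesics of a metric with energy $E$ are the regular curves on open intervals that are geodesics of the spray $\bar S$ determined by $i_{\bar S}\,dd_JE+d(d_CE-E)=0$, where $J$ is the vertical endomorphism and $C$ the Liouville field on $TG$. We say that $S$ is left-invariantly Riemann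 (resp. Finsler) metrizable if there is a left-invariant Riemannian (resp. Finsler) metric whose geodesics coincide with the geodesics of $S$, and left-invariantly projectively Riemann (resp. Finsler) metrizable if there is a left-invariant Riemannian (resp. Finsler) metric whose geodesics coincide with those of $S$ up to orientation-preserving smooth reparametrization. Then: 1. $S$ is left-invariantly projectively Riemann metrizable if and only if it is left-invariantly Riemann metrizable. 2. $S$ is left-invariantly projectively Finsler metrizable if and only if it is left-invariantly Finsler metrizable. 3. Every left-invariant Lagrangian $L\colon TG\to\mathbb R$, smooth on $TG\setminus\{0\}$, is a first integral of $S$: $S(L)=0$ on $TG\setminus\{0\}$. 4. Let $F\colon TG\to\mathbb R$ be left invariant and smooth on $TG\setminus\{0\}$. If $F$ satisfies the Euler–Lagrange equation $i_S\,dd_JF+d(d_CF-F)=0$ associated to $S$ on $TG\setminus\{0\}$, then so does $F^2/2$. -/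

import Mathlib

open Set Bundle
open scoped Manifold ContDiff

noncomputable section

namespace LieSpray

section Manifold

variable {E : Type*} [NormedAddCommGroup E] [NormedSpace ℝ E]
  {H : Type*} [TopologicalSpace H] (I : ModelWithCorners ℝ E H)
  {M : Type*} [TopologicalSpace M] [ChartedSpace H M] [IsManifold I ∞ M]

/-- The slit tangent bundle `TM \ {0}`. -/
def slit (M : Type*) [TopologicalSpace M] [ChartedSpace H M] : Set (TangentBundle I M) :=
  {v | v.2 ≠ 0}

/-- The velocity lift `γ̇ : ℝ → TM` of a curve `γ`. -/
def velocity (γ : ℝ → M) (t : ℝ) : TangentBundle I M :=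
  ⟨γ t, mfderiv 𝓘(ℝ, ℝ) I γ t (1 : ℝ)⟩

/-- The geodesics of a vector field `S` on `TM \ {0}` (in practice, of a spray): curves `γ`, defined
on an open interval `J`, whose velocity lift is an integral curve of `S` in `TM \ {0}`. Only the
values of `γ` on `J` matter. -/
def IsSprayGeodesic (S : (v : TangentBundle I M) → TangentSpace I.tangent v)
    (γ : ℝ → M) (J : Set ℝ) : Prop :=
  IsOpen J ∧ J.OrdConnected ∧ (∀ t ∈ J, velocity I γ t ∈ slit I M) ∧
    IsMIntegralCurveOn (I := I.tangent) (velocity I γ) S J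

/-! ### The Euler-Lagrange form, first in an induced chart `(x, y) ∈ E × E` of the tangent bundle -/

/-- The vertical endomorphism `J = dxⁱ ⊗ ∂/∂yⁱ` in an induced chart: `J (u, w) = (0, u)`. -/
def vertEnd (E : Type*) [NormedAddCommGroup E] [NormedSpace ℝ E] : E × E →L[ℝ] E × E :=
  (ContinuousLinearMap.inr ℝ E E).comp (ContinuousLinearMap.fst ℝ E E)

/-- The Liouville vector field `C = yⁱ ∂/∂yⁱ` in an induced chart: `C (x, y) = (0, y)`. -/
def liouville (p : E × E) : E × E := (0, p.2)

/-- The `1`-form `d_J ℓ = dℓ ∘ J`. -/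
def dJ (ℓ : E × E → ℝ) (p : E × E) : E × E →L[ℝ] ℝ := (fderiv ℝ ℓ p).comp (vertEnd E)

/-- The `2`-form `Ω_ℓ = d d_J ℓ`, i.e. `dθ (A, B) = A θ(B) - B θ(A)` (for constant fields `A`, `B`)
with `θ = d_J ℓ`. -/
def omega (ℓ : E × E → ℝ) (p A B : E × E) : ℝ :=
  fderiv ℝ (dJ ℓ) p A B - fderiv ℝ (dJ ℓ) p B A

/-- The value on `B` of the covector `i_A Ω_ℓ + d (d_C ℓ - ℓ)` at the point `p`. -/
def eulerLagrangeLocal (ℓ : E × E → ℝ) (p A B : E × E) : ℝ :=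
  omega ℓ p A B + fderiv ℝ (fun q ↦ fderiv ℝ ℓ q (liouville q) - ℓ q) p B

/-- For a function `L` on `TM`, a point `v ∈ TM` and `A ∈ T_v TM`, the covector
`i_A Ω_L + d (d_C L - L)` at `v`, evaluated on `B ∈ T_v TM`. It is computed in the preferred induced
chart of `TM` at `v`, in which a vector of `T_v TM` is by construction the pair of its components. -/
def eulerLagrangeForm (L : TangentBundle I M → ℝ) (v : TangentBundle I M)
    (A B : TangentSpace I.tangent v) : ℝ :=
  eulerLagrangeLocal (E := E) (L ∘ (extChartAt I.tangent v).symm) (extChartAt I.tangent v v) A B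

/-- `L` satisfies the Euler-Lagrange equation `ω_L = i_S Ω_L + d (d_C L - L) = 0` associated to the
vector field `S`, on `TM \ {0}`. -/
def SatisfiesEulerLagrange (S : (v : TangentBundle I M) → TangentSpace I.tangent v)
    (L : TangentBundle I M → ℝ) : Prop :=
  ∀ v ∈ slit I M, ∀ B : TangentSpace I.tangent v, eulerLagrangeForm I L v (S v) B = 0

/-- The geodesics of the metric with energy function `𝓔`, i.e. the geodesics of the spray `S`
determined by `i_S Ω_𝓔 + d (d_C 𝓔 - 𝓔) = 0`: regular curves on open intervals whose acceleration
`A = γ̈(t) ∈ T_{γ̇(t)} TM` satisfies `i_A Ω_𝓔 + d (d_C 𝓔 - 𝓔) = 0` at `γ̇(t)`. -/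
def IsEnergyGeodesic (𝓔 : TangentBundle I M → ℝ) (γ : ℝ → M) (J : Set ℝ) : Prop :=
  IsOpen J ∧ J.OrdConnected ∧ (∀ t ∈ J, velocity I γ t ∈ slit I M) ∧
    ∀ t ∈ J, ∃ A : TangentSpace I.tangent (velocity I γ t),
      HasMFDerivAt 𝓘(ℝ, ℝ) I.tangent (velocity I γ) t ((1 : ℝ →L[ℝ] ℝ).smulRight A) ∧
      ∀ B : TangentSpace I.tangent (velocity I γ t),
        eulerLagrangeForm I 𝓔 (velocity I γ t) A B = 0

/-- A Finsler metric (given by its Finsler function `F`): `F` is positive and smooth on `TM \ {0}`,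
positively homogeneous of degree `1`, and the fibre Hessian of `F² / 2` is positive definite at every
point of `TM \ {0}`. -/
structure IsFinsler (F : TangentBundle I M → ℝ) : Prop where
  pos : ∀ v ∈ slit I M, 0 < F v
  homogeneous : ∀ (x : M) (y : TangentSpace I x) (c : ℝ), 0 ≤ c → F ⟨x, c • y⟩ = c * F ⟨x, y⟩
  smooth : ContMDiffOn I.tangent 𝓘(ℝ, ℝ) ∞ F (slit I M)
  hessian_pos : ∀ (x : M) (y u : TangentSpace I x), y ≠ 0 → u ≠ 0 →
    0 < iteratedDeriv 2 (fun s : ℝ ↦ F ⟨x, y + s • u⟩ ^ 2 / 2) 0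

/-- The energy function `𝓔 = F² / 2` of a Finsler function. -/
def finslerEnergy (F : TangentBundle I M → ℝ) (v : TangentBundle I M) : ℝ := F v ^ 2 / 2

/-- The energy function `𝓔 (v) = g (v, v) / 2` of a Riemannian metric. -/
def riemannEnergy (g : ContMDiffRiemannianMetric I ∞ E (fun x : M ↦ TangentSpace I x))
    (v : TangentBundle I M) : ℝ :=
  g.inner v.1 v.2 v.2 / 2

end Manifold

section Curves

variable {M : Type*}

/-- `φ : J' → J` is an orientation preserving smooth change of parameter between open intervals. -/
def IsReparametrization (φ : ℝ → ℝ) (J' J : Set ℝ) : Prop :=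
  IsOpen J' ∧ J'.OrdConnected ∧ ContDiffOn ℝ ∞ φ J' ∧ (∀ t ∈ J', 0 < deriv φ t) ∧ φ '' J' = J

/-- Two families of curves (on intervals `J`) coincide. -/
def SameCurves (𝒜 ℬ : (ℝ → M) → Set ℝ → Prop) : Prop :=
  ∀ γ J, 𝒜 γ J ↔ ℬ γ J

/-- Two families of curves are projectively equivalent: they coincide up to orientation preserving
reparametrization. -/
def ProjectivelyEquivalent (𝒜 ℬ : (ℝ → M) → Set ℝ → Prop) : Prop :=
  (∀ γ J, 𝒜 γ J → ∃ φ J', IsReparametrization φ J' J ∧ ℬ (γ ∘ φ) J') ∧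
  (∀ γ J, ℬ γ J → ∃ φ J', IsReparametrization φ J' J ∧ 𝒜 (γ ∘ φ) J')

end Curves

section Group

variable {E : Type*} [NormedAddCommGroup E] [NormedSpace ℝ E]
  {H : Type*} [TopologicalSpace H] (I : ModelWithCorners ℝ E H)
  {G : Type*} [TopologicalSpace G] [ChartedSpace H G] [Group G] [LieGroup I ∞ G]

/-- The Maurer-Cartan form `θ : TG → 𝔤`, `θ (v) = (λ_{x⁻¹})_* v` for `v ∈ T_x G`. -/
def maurerCartan (v : TangentBundle I G) : GroupLieAlgebra I G :=
  mfderiv I I (fun h : G ↦ v.1⁻¹ * h) v.1 v.2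

/-- The canonical spray of `G`: at `v ∈ T_x G` with `α = θ (v)`, its value is the image of `v` under
the differential at `x` of the left invariant vector field `g ↦ (λ_g)_* α`, seen as a map `G → TG`.
In the left trivialization `TG ≅ G × 𝔤` that map is `g ↦ (g, α)` and `v = λ_x α`, so that
`S_{(x, α)} = λ_x α ∂/∂x`. -/
def canonicalSpray (v : TangentBundle I G) : TangentSpace I.tangent v :=
  mfderiv I I.tangent
    (fun g : G ↦ (⟨g, mulInvariantVectorField (maurerCartan I v) g⟩ : TangentBundle I G)) v.1 v.2

/-- A function `L` on `TG` is left invariant if `L ∘ (λ_a)_* = L` for every `a ∈ G`. -/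
def LeftInvariant (L : TangentBundle I G → ℝ) : Prop :=
  ∀ (a : G) (v : TangentBundle I G), L (tangentMap I I (fun h : G ↦ a * h) v) = L v

/-- A Riemannian metric on `G` is left invariant if all left translations are isometries. -/
def LeftInvariantMetric
    (g : ContMDiffRiemannianMetric I ∞ E (fun x : G ↦ TangentSpace I x)) : Prop :=
  ∀ (a x : G) (u w : TangentSpace I x),
    g.inner (a * x) (mfderiv I I (fun h : G ↦ a * h) x u) (mfderiv I I (fun h : G ↦ a * h) x w) =
      g.inner x u w

/-- Some left invariant Riemannian metric has the same geodesics as `S`. -/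
def LeftInvRiemannMetrizable (S : (v : TangentBundle I G) → TangentSpace I.tangent v) : Prop :=
  ∃ g : ContMDiffRiemannianMetric I ∞ E (fun x : G ↦ TangentSpace I x),
    LeftInvariantMetric I g ∧
      SameCurves (IsSprayGeodesic I S) (IsEnergyGeodesic I (riemannEnergy I g))

/-- Some left invariant Finsler metric has the same geodesics as `S`. -/
def LeftInvFinslerMetrizable (S : (v : TangentBundle I G) → TangentSpace I.tangent v) : Prop :=
  ∃ F : TangentBundle I G → ℝ, IsFinsler I F ∧ LeftInvariant I F ∧
    SameCurves (IsSprayGeodesic I S) (IsEnergyGeodesic I (finslerEnergy I F))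

/-- Some left invariant Riemannian metric has geodesics projectively equivalent to those of `S`. -/
def LeftInvProjRiemannMetrizable (S : (v : TangentBundle I G) → TangentSpace I.tangent v) : Prop :=
  ∃ g : ContMDiffRiemannianMetric I ∞ E (fun x : G ↦ TangentSpace I x),
    LeftInvariantMetric I g ∧
      ProjectivelyEquivalent (IsSprayGeodesic I S) (IsEnergyGeodesic I (riemannEnergy I g))

/-- Some left invariant Finsler metric has geodesics projectively equivalent to those of `S`. -/
def LeftInvProjFinslerMetrizable (S : (v : TangentBundle I G) → TangentSpace I.tangent v) : Prop :=
  ∃ F : TangentBundle I G → ℝ, IsFinsler I F ∧ LeftInvariant I F ∧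
    ProjectivelyEquivalent (IsSprayGeodesic I S) (IsEnergyGeodesic I (finslerEnergy I F))

end Group

end LieSpray

end

/-!
The value `S_v` of the canonical spray of a Lie group, for `v = (λ_x)_* α`, is the image of `v` under
the differential at `x` of the left invariant field `g ↦ (λ_g)_* α`, seen as a map `G → TG`. A left invariant function on `TG` is constant on the image of this map, so it is a
first integral of `S` (`LieSpray.LeftInvariant.mfderiv_canonicalSpray`).

For the metrizability statements the same metric serves on both sides. Let `𝓔` be its energy,
positive, `2`-homogeneous and left invariant. Reparametrizing a curve changes its acceleration,
after rescaling the velocity, by a multiple `r C` of the Liouville field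
(`LieSpray.HasAcceleration.comp`). So projective equivalence gives, at each velocity in question, a
vector `A = S + r C` with `i_A Ω_𝓔 + d𝓔 = 0`. Evaluating on `A` gives
`0 = d𝓔 (A) = S 𝓔 + r C 𝓔 = 2 r 𝓔`, whence `r = 0` (`LieSpray.vertical_coeff_eq_zero`). Both `S`
and the Euler-Lagrange equation of `𝓔` are equivariant under positive multiplication of velocities
(`LieSpray.canonicalSpray_fibreSmul`, `LieSpray.eulerLagrangeForm_fibreSmul`), and the geodesics
coincide (`LieSpray.sameCurves_of_projectivelyEquivalent`). The argument is pointwise along a given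
curve and needs no existence theorem for geodesics.

For the last statement, a direct computation shows that, at vectors `A` with `J A = C` and
`dF (A) = 0`, the Euler-Lagrange covector of `F² / 2` is `F` times that of `F`
(`LieSpray.eulerLagrangeLocal_sq_div_two`).
-/

namespace LieSpray

/-! ### Fibre multiplication in the charts of the tangent bundle -/

section TangentCoordinates

variable {E : Type*} [NormedAddCommGroup E] [NormedSpace ℝ E]
  {H : Type*} [TopologicalSpace H] {I : ModelWithCorners ℝ E H}
  {M : Type*} [TopologicalSpace M] [ChartedSpace H M] [IsManifold I ∞ M]

variable (I) in
/-- Multiplication by `c` in the fibres of the tangent bundle, `(x, y) ↦ (x, c y)`. -/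
noncomputable def fibreSmul (c : ℝ) (v : TangentBundle I M) : TangentBundle I M := ⟨v.1, c • v.2⟩

/-- In the preferred chart at `v` fibre multiplication is `(x, y) ↦ (x, c y)`. No condition on the base point of `w` is needed, as the
coordinate changes are linear everywhere. -/
theorem extChartAt_fibreSmul (c : ℝ) (v w : TangentBundle I M) :
    extChartAt I.tangent v (fibreSmul I c w) =
      ((extChartAt I.tangent v w).1, c • (extChartAt I.tangent v w).2) := by
  have h (w : TangentBundle I M) : extChartAt I.tangent v w =
      (extChartAt I v.1 w.1, tangentCoordChange I w.1 v.1 w.1 w.2) := rfl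
  rw [h, h]
  exact congrArg (Prod.mk _) ((tangentCoordChange I w.1 v.1 w.1).map_smul c w.2)

/-- The chart at `v` reads the fibre over the base point of `v` through the identity. -/
theorem extChartAt_self_snd (v : TangentBundle I M) : (extChartAt I.tangent v v).2 = v.2 :=
  tangentCoordChange_self (I := I) (mem_extChartAt_source v.1)

theorem mem_slit_of_extChartAt_snd_ne_zero {v w : TangentBundle I M}
    (h : (extChartAt I.tangent v w).2 ≠ 0) : w ∈ slit I M := by
  intro h0
  apply h
  have h1 : fibreSmul I 0 w = w := by
    obtain ⟨x, y⟩ := w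
    have hy : y = 0 := h0
    subst hy
    exact congrArg (TotalSpace.mk x) (smul_zero (0 : ℝ))
  rw [← h1, extChartAt_fibreSmul, zero_smul]

theorem slit_mem_nhds {v : TangentBundle I M} (hv : v ∈ slit I M) : slit I M ∈ nhds v := by
  have hc : ContinuousAt (fun w ↦ (extChartAt I.tangent v w).2) v :=
    (continuousAt_extChartAt v).snd
  have hne : (extChartAt I.tangent v v).2 ≠ 0 := by rw [extChartAt_self_snd]; exact hv
  filter_upwards [hc.eventually_ne hne] with w hw
  exact mem_slit_of_extChartAt_snd_ne_zero hw

variable {E' : Type*} [NormedAddCommGroup E'] [NormedSpace ℝ E']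
  {H' : Type*} [TopologicalSpace H'] {I' : ModelWithCorners ℝ E' H'}
  {N : Type*} [TopologicalSpace N] [ChartedSpace H' N]

/-- Product rule for `m ↦ a(m) V(m)` with `V` a map into `TM`: in the preferred chart the differential
of `(x, y) ↦ (x, a y)` is `(ẋ, ẏ) ↦ (ẋ, a ẏ + ȧ y)`. -/
theorem hasMFDerivAt_fibreSmul {V : N → TangentBundle I M} {a : N → ℝ} {n : N}
    {A : E' →L[ℝ] E × E} {r : E' →L[ℝ] ℝ}
    (hV : HasMFDerivAt I' I.tangent V n A) (ha : HasMFDerivAt I' 𝓘(ℝ, ℝ) a n r) :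
    HasMFDerivAt I' I.tangent (fun m ↦ fibreSmul I (a m) (V m)) n
      (((ContinuousLinearMap.fst ℝ E E).comp A).prod
        (a n • (ContinuousLinearMap.snd ℝ E E).comp A + ContinuousLinearMap.smulRight (M₂ := E) r (V n).2)) := by
  refine ⟨?_, ?_⟩
  · have h := (FiberBundle.continuousAt_totalSpace E V).1 hV.1
    refine (FiberBundle.continuousAt_totalSpace E _).2 ⟨h.1, ?_⟩
    refine (ha.1.smul h.2).congr (Filter.Eventually.of_forall fun m ↦ ?_)
    exact (congrArg Prod.snd (extChartAt_fibreSmul (a m) (V n) (V m))).symm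
  · have h1 : HasFDerivWithinAt (writtenInExtChartAt I' I.tangent n V : E' → E × E) A
        (range I') (extChartAt I' n n) := hV.2
    have h2 : HasFDerivWithinAt (writtenInExtChartAt I' 𝓘(ℝ, ℝ) n a : E' → ℝ) r
        (range I') (extChartAt I' n n) := ha.2
    have h3 := h1.fst.prodMk (h2.smul h1.snd)
    have e1 : writtenInExtChartAt I' I.tangent n V (extChartAt I' n n) =
        extChartAt I.tangent (V n) (V n) := by simp [writtenInExtChartAt]
    have e2 : writtenInExtChartAt I' 𝓘(ℝ, ℝ) n a (extChartAt I' n n) = a n := by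
      simp only [writtenInExtChartAt, extChartAt_model_space_eq_id, PartialEquiv.refl_coe,
        Function.comp_apply, id, extChartAt_to_inv]
    rw [e1, e2, extChartAt_self_snd] at h3
    refine h3.congr_of_eventuallyEq (Filter.Eventually.of_forall fun q ↦ ?_) ?_
    · exact extChartAt_fibreSmul _ (V n) _
    · exact extChartAt_fibreSmul _ (V n) _

/-- In the preferred chart at `v` the differential of `TM → M` is `(u, w) ↦ u`. -/
theorem hasMFDerivAt_proj (v : TangentBundle I M) :
    HasMFDerivAt I.tangent I (TotalSpace.proj : TangentBundle I M → M) v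
      (ContinuousLinearMap.fst ℝ E E) := by
  refine ⟨FiberBundle.continuous_proj E _ |>.continuousAt, ?_⟩
  refine (ContinuousLinearMap.fst ℝ E E).hasFDerivWithinAt.congr_of_eventuallyEq ?_ ?_
  · filter_upwards [extChartAt_target_mem_nhdsWithin v] with q hq
    exact congrArg Prod.fst ((extChartAt I.tangent v).right_inv hq)
  · exact congrArg Prod.fst ((extChartAt I.tangent v).right_inv (mem_extChartAt_target v))

end TangentCoordinates

/-! ### The Euler-Lagrange covector in a chart -/

section LocalEulerLagrange

variable {E : Type*} [NormedAddCommGroup E] [NormedSpace ℝ E]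

theorem eventually_differentiableAt {ℓ : E × E → ℝ} {p : E × E} (hℓ : ContDiffAt ℝ 2 ℓ p) :
    ∀ᶠ q in nhds p, DifferentiableAt ℝ ℓ q := by
  filter_upwards [hℓ.eventually (by simp)] with q hq
  exact hq.differentiableAt (by simp)

theorem differentiableAt_fderiv {ℓ : E × E → ℝ} {p : E × E} (hℓ : ContDiffAt ℝ 2 ℓ p) :
    DifferentiableAt ℝ (fderiv ℝ ℓ) p :=
  (hℓ.fderiv_right (m := 1) (by norm_num)).differentiableAt (by simp)

theorem differentiableAt_dJ {ℓ : E × E → ℝ} {p : E × E} (hℓ : ContDiffAt ℝ 2 ℓ p) :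
    DifferentiableAt ℝ (dJ ℓ) p :=
  (differentiableAt_fderiv hℓ).clm_comp (differentiableAt_const _)

theorem liouville_eq_vertEnd {p A : E × E} (hA : A.1 = p.2) : vertEnd E A = liouville p := by
  simp [vertEnd, liouville, hA]

/-- If `A` is second order at `p` (that is, `J A = C`) and `df(A) = 0`, the Euler-Lagrange covector of
`f² / 2` is `f` times that of `f`: the cross terms of `d (f d_J f)` contribute `-C(f) df`, and those
of `d (C(f² / 2) - f² / 2)` contribute `C(f) df`. -/
theorem eulerLagrangeLocal_sq_div_two {f : E × E → ℝ} {p A : E × E} (hf : ContDiffAt ℝ 2 f p)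
    (hA : A.1 = p.2) (hfA : fderiv ℝ f p A = 0) (B : E × E) :
    eulerLagrangeLocal (fun q ↦ f q ^ 2 / 2) p A B = f p * eulerLagrangeLocal f p A B := by
  have hfp : DifferentiableAt ℝ f p := hf.differentiableAt (by simp)
  have hd (q : E × E) (hq : DifferentiableAt ℝ f q) :
      fderiv ℝ (fun q ↦ f q ^ 2 / 2) q = f q • fderiv ℝ f q := by
    refine HasFDerivAt.fderiv ?_
    have h := (hq.hasFDerivAt.pow 2).mul_const (1 / 2 : ℝ)
    refine (h.congr_of_eventuallyEq (Filter.Eventually.of_forall fun q ↦ ?_)).congr_fderiv ?_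
    · simp [div_eq_mul_inv]
    · ext <;> simp <;> ring
  have hθ : dJ (fun q ↦ f q ^ 2 / 2) =ᶠ[nhds p] fun q ↦ f q • dJ f q := by
    filter_upwards [eventually_differentiableAt hf] with q hq
    ext B <;> simp [dJ, hd q hq]
  have hdθ : fderiv ℝ (dJ fun q ↦ f q ^ 2 / 2) p =
      f p • fderiv ℝ (dJ f) p + (fderiv ℝ f p).smulRight (dJ f p) := by
    rw [hθ.fderiv_eq]
    exact (hfp.hasFDerivAt.smul (differentiableAt_dJ hf).hasFDerivAt).fderiv
  have hc : DifferentiableAt ℝ (fun q ↦ fderiv ℝ f q (liouville q)) p :=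
    (differentiableAt_fderiv hf).clm_apply
      ((differentiableAt_const (0 : E)).prodMk differentiableAt_snd)
  have he : (fun q ↦ fderiv ℝ (fun q ↦ f q ^ 2 / 2) q (liouville q) - f q ^ 2 / 2)
      =ᶠ[nhds p] fun q ↦ f q * fderiv ℝ f q (liouville q) - f q ^ 2 / 2 := by
    filter_upwards [eventually_differentiableAt hf] with q hq
    simp [hd q hq]
  have hsq : DifferentiableAt ℝ (fun q ↦ f q ^ 2 / 2) p := by
    simpa [div_eq_mul_inv] using (hfp.pow 2).mul_const (2⁻¹ : ℝ)
  have hde : fderiv ℝ (fun q ↦ fderiv ℝ (fun q ↦ f q ^ 2 / 2) q (liouville q) - f q ^ 2 / 2) p =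
      f p • fderiv ℝ (fun q ↦ fderiv ℝ f q (liouville q)) p +
        fderiv ℝ f p (liouville p) • fderiv ℝ f p - f p • fderiv ℝ f p := by
    rw [he.fderiv_eq, fderiv_fun_sub (hfp.fun_mul hc) hsq, fderiv_fun_mul hfp hc, hd p hfp]
  have hCA : dJ f p A = fderiv ℝ f p (liouville p) :=
    congrArg (fderiv ℝ f p) (liouville_eq_vertEnd hA)
  unfold eulerLagrangeLocal omega
  rw [hdθ, hde, fderiv_fun_sub hc hfp]
  simp [hfA, hCA]
  ring

/-- Euler's identity `C ℓ = 2 ℓ` for a fibrewise `2`-homogeneous `ℓ`. -/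
theorem fderiv_liouville_of_homogeneous {ℓ : E × E → ℝ} {q : E × E}
    (hq : DifferentiableAt ℝ ℓ q) (hℓ : ∀ c : ℝ, 0 < c → ℓ (q.1, c • q.2) = c ^ 2 * ℓ q) :
    fderiv ℝ ℓ q (liouville q) = 2 * ℓ q := by
  have h1 : HasDerivAt (fun c : ℝ ↦ (q.1, c • q.2)) (liouville q) 1 := by
    have := (hasDerivAt_const (1 : ℝ) q.1).prodMk ((hasDerivAt_id (1 : ℝ)).smul_const q.2)
    simpa [liouville] using this
  have h2 : HasDerivAt (fun c : ℝ ↦ ℓ (q.1, c • q.2)) (fderiv ℝ ℓ q (liouville q)) 1 := by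
    refine HasFDerivAt.comp_hasDerivAt (1 : ℝ) ?_ h1
    simpa using hq.hasFDerivAt
  have h3 : HasDerivAt (fun c : ℝ ↦ c ^ 2 * ℓ q) (2 * ℓ q) 1 := by
    simpa using (hasDerivAt_pow 2 (1 : ℝ)).mul_const (ℓ q)
  refine h2.unique (h3.congr_of_eventuallyEq ?_)
  filter_upwards [lt_mem_nhds (zero_lt_one : (0 : ℝ) < 1)] with c hc
  exact hℓ c hc

theorem eulerLagrangeLocal_of_homogeneous {ℓ : E × E → ℝ} {p : E × E} (hp : ContDiffAt ℝ 2 ℓ p)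
    (hℓ : ∀ᶠ q in nhds p, ∀ c : ℝ, 0 < c → ℓ (q.1, c • q.2) = c ^ 2 * ℓ q) (A B : E × E) :
    eulerLagrangeLocal ℓ p A B = omega ℓ p A B + fderiv ℝ ℓ p B := by
  have h : (fun q ↦ fderiv ℝ ℓ q (liouville q) - ℓ q) =ᶠ[nhds p] ℓ := by
    filter_upwards [hℓ, eventually_differentiableAt hp] with q hq hd
    rw [fderiv_liouville_of_homogeneous hd hq]
    ring
  rw [eulerLagrangeLocal, h.fderiv_eq]

/-- The derivative of `d_J ℓ` is the second derivative of `ℓ` with its last argument made vertical. -/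
theorem fderiv_dJ_apply {ℓ : E × E → ℝ} {p : E × E} (hp : ContDiffAt ℝ 2 ℓ p) (A B : E × E) :
    fderiv ℝ (dJ ℓ) p A B = fderiv ℝ (fderiv ℝ ℓ) p A (vertEnd E B) := by
  unfold dJ
  rw [fderiv_clm_comp (differentiableAt_fderiv hp) (differentiableAt_const _)]
  simp

/-- Equivariance of the Euler-Lagrange covector of a `2`-homogeneous `ℓ` under `h (x, y) = (x, c y)`.
The vector put at `h p` is `c • h_* A`, the factor by which a spray scales. -/
theorem eulerLagrangeLocal_fibreSmul {ℓ : E × E → ℝ} {p : E × E} {c : ℝ} (hc : 0 < c)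
    (hp : ContDiffAt ℝ 2 ℓ p) (hcp : ContDiffAt ℝ 2 ℓ (p.1, c • p.2))
    (hℓ : ∀ᶠ q in nhds p, ∀ c : ℝ, 0 < c → ℓ (q.1, c • q.2) = c ^ 2 * ℓ q)
    (hℓ' : ∀ᶠ q in nhds (p.1, c • p.2), ∀ c : ℝ, 0 < c → ℓ (q.1, c • q.2) = c ^ 2 * ℓ q)
    (A B : E × E) :
    eulerLagrangeLocal ℓ (p.1, c • p.2) (c • A.1, c ^ 2 • A.2) (B.1, c • B.2) =
      c ^ 2 * eulerLagrangeLocal ℓ p A B := by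
  let h : (E × E) →L[ℝ] (E × E) :=
    (ContinuousLinearMap.id ℝ E).prodMap (c • ContinuousLinearMap.id ℝ E)
  have hh (A : E × E) : h A = (A.1, c • A.2) := rfl
  -- The vertical endomorphism takes only the base component, whereas `h` scales the fibre one.
  have hJ (A : E × E) : c • vertEnd E A = h (vertEnd E A) := by simp [hh, vertEnd]
  have hdh : Filter.Tendsto h (nhds p) (nhds (h p)) := h.continuous.continuousAt
  rw [← hh] at hcp
  have h1 : ∀ᶠ q in nhds p, (fderiv ℝ ℓ (h q)).comp h = c ^ 2 • fderiv ℝ ℓ q := by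
    filter_upwards [hℓ.eventually_nhds, eventually_differentiableAt hp,
      hdh.eventually (eventually_differentiableAt hcp)] with q hq hd hd'
    have e : ℓ ∘ h =ᶠ[nhds q] fun q ↦ c ^ 2 * ℓ q := by
      filter_upwards [hq] with r hr using hr c hc
    rw [← (hd'.hasFDerivAt.comp q h.hasFDerivAt).fderiv, e.fderiv_eq, fderiv_const_mul hd]
  have h2 (A B : E × E) : fderiv ℝ (fderiv ℝ ℓ) (h p) (h A) (h B) =
      c ^ 2 * fderiv ℝ (fderiv ℝ ℓ) p A B := by
    have e1 := ((differentiableAt_fderiv hcp).hasFDerivAt.comp p h.hasFDerivAt).clm_comp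
      (hasFDerivAt_const h p)
    have e2 := (differentiableAt_fderiv hp).hasFDerivAt.const_smul (c ^ 2)
    have e3 := e1.unique (e2.congr_of_eventuallyEq h1)
    simpa using congrArg (fun T ↦ T A B) e3
  have h3 (B : E × E) : fderiv ℝ ℓ (h p) (h B) = c ^ 2 * fderiv ℝ ℓ p B := by
    simpa using congrArg (fun T ↦ T B) h1.self_of_nhds
  have hA : (c • A.1, c ^ 2 • A.2) = c • h A := by simp [hh, pow_two, smul_smul]
  have hJh (A : E × E) : vertEnd E (h A) = vertEnd E A := rfl
  rw [eulerLagrangeLocal_of_homogeneous hp hℓ, ← hh p, ← hh B, hA,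
    eulerLagrangeLocal_of_homogeneous hcp hℓ', omega, omega]
  rw [fderiv_dJ_apply hp, fderiv_dJ_apply hp, fderiv_dJ_apply hcp, fderiv_dJ_apply hcp, h3]
  have e1 : fderiv ℝ (fderiv ℝ ℓ) (h p) (c • h A) (vertEnd E (h B)) =
      fderiv ℝ (fderiv ℝ ℓ) (h p) (h A) (h (vertEnd E B)) := by
    rw [← hJ, hJh]; simp
  have e2 : fderiv ℝ (fderiv ℝ ℓ) (h p) (h B) (vertEnd E (c • h A)) =
      fderiv ℝ (fderiv ℝ ℓ) (h p) (h B) (h (vertEnd E A)) := by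
    rw [← hJ, map_smul, hJh]
  rw [e1, e2, h2, h2]
  ring

end LocalEulerLagrange

/-! ### The Euler-Lagrange covector of a homogeneous energy on the tangent bundle -/

section TangentCoordinates

variable {E : Type*} [NormedAddCommGroup E] [NormedSpace ℝ E]
  {H : Type*} [TopologicalSpace H] {I : ModelWithCorners ℝ E H} [I.Boundaryless]
  {M : Type*} [TopologicalSpace M] [ChartedSpace H M] [IsManifold I ∞ M]

theorem contDiffAt_comp_extChartAt_symm {L : TangentBundle I M → ℝ}
    (hL : ContMDiffOn I.tangent 𝓘(ℝ, ℝ) ∞ L (slit I M)) {v : TangentBundle I M}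
    (hv : v ∈ slit I M) :
    ContDiffAt ℝ 2 (L ∘ (extChartAt I.tangent v).symm) (extChartAt I.tangent v v) := by
  have h := (contMDiffAt_iff.1 (hL.contMDiffAt (slit_mem_nhds hv))).2
  rw [ModelWithCorners.range_eq_univ, contDiffWithinAt_univ] at h
  exact h.of_le ENat.LEInfty.out

theorem mfderiv_apply_eq_fderiv {L : TangentBundle I M → ℝ}
    (hL : ContMDiffOn I.tangent 𝓘(ℝ, ℝ) ∞ L (slit I M)) {v : TangentBundle I M}
    (hv : v ∈ slit I M) (A : E × E) :
    mfderiv I.tangent 𝓘(ℝ, ℝ) L v A =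
      fderiv ℝ (L ∘ (extChartAt I.tangent v).symm) (extChartAt I.tangent v v) A := by
  have h : MDifferentiableAt I.tangent 𝓘(ℝ, ℝ) L v :=
    (hL.contMDiffAt (slit_mem_nhds hv)).mdifferentiableAt (by simp)
  rw [h.mfderiv, ModelWithCorners.range_eq_univ, fderivWithin_univ]
  rfl

omit [I.Boundaryless] in
theorem extChartAt_symm_fibreSmul (c : ℝ) (v : TangentBundle I M) {q : E × E}
    (hq : q ∈ (extChartAt I.tangent v).target) :
    (extChartAt I.tangent v).symm (q.1, c • q.2) =
      fibreSmul I c ((extChartAt I.tangent v).symm q) := by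
  have hw : fibreSmul I c ((extChartAt I.tangent v).symm q) ∈ (extChartAt I.tangent v).source := by
    have h := (extChartAt I.tangent v).map_target hq
    rw [extChartAt_source, TangentBundle.mem_chart_source_iff] at h ⊢
    exact h
  rw [← (extChartAt I.tangent v).left_inv hw, extChartAt_fibreSmul,
    (extChartAt I.tangent v).right_inv hq]

theorem eventually_homogeneous {𝓔 : TangentBundle I M → ℝ}
    (hom : ∀ (c : ℝ) (v : TangentBundle I M), 0 < c → 𝓔 (fibreSmul I c v) = c ^ 2 * 𝓔 v)
    (v : TangentBundle I M) :
    ∀ᶠ q in nhds (extChartAt I.tangent v v), ∀ c : ℝ, 0 < c →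
      (𝓔 ∘ (extChartAt I.tangent v).symm) (q.1, c • q.2) =
        c ^ 2 * (𝓔 ∘ (extChartAt I.tangent v).symm) q := by
  filter_upwards [extChartAt_target_mem_nhds v] with q hq c hc
  rw [Function.comp_apply, extChartAt_symm_fibreSmul c v hq, hom c _ hc, Function.comp_apply]

omit [I.Boundaryless] in
/-- The preferred chart at a vector depends only on its base point, so the charts at `c v` and at `v`
are the same. -/
theorem extChartAt_self_fibreSmul (c : ℝ) (v : TangentBundle I M) :
    extChartAt I.tangent (fibreSmul I c v) (fibreSmul I c v) =
      ((extChartAt I.tangent v v).1, c • (extChartAt I.tangent v v).2) :=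
  extChartAt_fibreSmul c v v

theorem eulerLagrangeForm_fibreSmul {𝓔 : TangentBundle I M → ℝ}
    (hsmooth : ContMDiffOn I.tangent 𝓘(ℝ, ℝ) ∞ 𝓔 (slit I M))
    (hom : ∀ (c : ℝ) (v : TangentBundle I M), 0 < c → 𝓔 (fibreSmul I c v) = c ^ 2 * 𝓔 v)
    {c : ℝ} (hc : 0 < c) {v : TangentBundle I M} (hv : v ∈ slit I M) (A B : E × E) :
    eulerLagrangeForm I 𝓔 (fibreSmul I c v) ((c • A.1, c ^ 2 • A.2) : E × E)
      ((B.1, c • B.2) : E × E) = c ^ 2 * eulerLagrangeForm I 𝓔 v A B := by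
  have hcv : fibreSmul I c v ∈ slit I M := smul_ne_zero (M := E) hc.ne' hv
  have h1 := contDiffAt_comp_extChartAt_symm hsmooth hcv
  have h2 := eventually_homogeneous hom (fibreSmul I c v)
  rw [extChartAt_self_fibreSmul] at h1 h2
  have h := eulerLagrangeLocal_fibreSmul hc (contDiffAt_comp_extChartAt_symm hsmooth hv) h1
    (eventually_homogeneous hom v) h2 A B
  unfold eulerLagrangeForm
  rw [extChartAt_self_fibreSmul]
  exact h

/-- Conservation of energy: evaluating `i_A Ω_𝓔 + d𝓔 = 0` on `A` itself kills the `2`-form and leaves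
`d𝓔(A) = 0`. -/
theorem mfderiv_eq_zero_of_eulerLagrangeForm_self {𝓔 : TangentBundle I M → ℝ}
    (hsmooth : ContMDiffOn I.tangent 𝓘(ℝ, ℝ) ∞ 𝓔 (slit I M))
    (hom : ∀ (c : ℝ) (v : TangentBundle I M), 0 < c → 𝓔 (fibreSmul I c v) = c ^ 2 * 𝓔 v)
    {v : TangentBundle I M} (hv : v ∈ slit I M) {A : E × E}
    (hA : eulerLagrangeForm I 𝓔 v A A = 0) : mfderiv I.tangent 𝓘(ℝ, ℝ) 𝓔 v A = 0 := by
  rw [mfderiv_apply_eq_fderiv hsmooth hv]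
  have h := eulerLagrangeLocal_of_homogeneous (contDiffAt_comp_extChartAt_symm hsmooth hv)
    (eventually_homogeneous hom v) A A
  rw [omega, sub_self, zero_add] at h
  exact h.symm.trans hA

/-- Euler's identity on `TM`: the Liouville field `C` satisfies `C 𝓔 = 2 𝓔`. -/
theorem mfderiv_vertical {𝓔 : TangentBundle I M → ℝ}
    (hsmooth : ContMDiffOn I.tangent 𝓘(ℝ, ℝ) ∞ 𝓔 (slit I M))
    (hom : ∀ (c : ℝ) (v : TangentBundle I M), 0 < c → 𝓔 (fibreSmul I c v) = c ^ 2 * 𝓔 v)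
    {v : TangentBundle I M} (hv : v ∈ slit I M) :
    mfderiv I.tangent 𝓘(ℝ, ℝ) 𝓔 v ((0, v.2) : E × E) = 2 * 𝓔 v := by
  rw [mfderiv_apply_eq_fderiv hsmooth hv]
  have h := fderiv_liouville_of_homogeneous
    ((contDiffAt_comp_extChartAt_symm hsmooth hv).differentiableAt (by simp))
    (eventually_homogeneous hom v).self_of_nhds
  rw [liouville, extChartAt_self_snd, Function.comp_apply, extChartAt_to_inv] at h
  exact h

/-- If `A = S + r C` satisfies the Euler-Lagrange equation of a positive `2`-homogeneous energy that is
constant along `S`, then `r = 0`: indeed `0 = d𝓔(A) = d𝓔(S) + r d𝓔(C) = 2 r 𝓔`. -/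
theorem vertical_coeff_eq_zero {𝓔 : TangentBundle I M → ℝ}
    (hsmooth : ContMDiffOn I.tangent 𝓘(ℝ, ℝ) ∞ 𝓔 (slit I M))
    (hom : ∀ (c : ℝ) (v : TangentBundle I M), 0 < c → 𝓔 (fibreSmul I c v) = c ^ 2 * 𝓔 v)
    {v : TangentBundle I M} (hv : v ∈ slit I M) (hpos : 0 < 𝓔 v) {S A : E × E} {r : ℝ}
    (hS : mfderiv I.tangent 𝓘(ℝ, ℝ) 𝓔 v S = 0) (hSA : A = S + r • ((0, v.2) : E × E))
    (hA : eulerLagrangeForm I 𝓔 v A A = 0) : r = 0 := by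
  have h := mfderiv_eq_zero_of_eulerLagrangeForm_self hsmooth hom hv hA
  let D : E × E →L[ℝ] ℝ := mfderiv I.tangent 𝓘(ℝ, ℝ) 𝓔 v
  have h1 : D A = 0 := h
  have h2 : D S = 0 := hS
  have h3 : D ((0, v.2) : E × E) = 2 * 𝓔 v := mfderiv_vertical hsmooth hom hv
  rw [hSA, map_add, map_smul, h2, h3, zero_add, smul_eq_mul] at h1
  rcases mul_eq_zero.1 h1 with h | h
  · exact h
  · linarith

end TangentCoordinates

/-! ### Geodesics and reparametrizations -/

section Geodesics

variable {E : Type*} [NormedAddCommGroup E] [NormedSpace ℝ E]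
  {H : Type*} [TopologicalSpace H] {I : ModelWithCorners ℝ E H}
  {M : Type*} [TopologicalSpace M] [ChartedSpace H M] [IsManifold I ∞ M]

omit [IsManifold I ∞ M] in
theorem velocity_comp {γ : ℝ → M} {φ : ℝ → ℝ} {s : ℝ} (hγ : velocity I γ (φ s) ∈ slit I M)
    (hφ : DifferentiableAt ℝ φ s) :
    velocity I (γ ∘ φ) s = fibreSmul I (deriv φ s) (velocity I γ (φ s)) := by
  have hd : MDifferentiableAt 𝓘(ℝ, ℝ) I γ (φ s) := by
    -- Otherwise `mfderiv` is zero, which contradicts that the velocity is in the slit bundle.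
    by_contra h
    refine hγ ?_
    rw [velocity, mfderiv_zero_of_not_mdifferentiableAt h]
    rfl
  have h := hd.hasMFDerivAt.comp s hφ.hasDerivAt.hasFDerivAt.hasMFDerivAt
  let D : ℝ →L[ℝ] E := mfderiv 𝓘(ℝ, ℝ) I γ (φ s)
  have e : D ((ContinuousLinearMap.toSpanSingleton ℝ (deriv φ s) : ℝ →L[ℝ] ℝ) (1 : ℝ)) =
      deriv φ s • D (1 : ℝ) := by
    rw [← map_smul]; simp
  rw [velocity, h.mfderiv]
  exact congrArg (TotalSpace.mk (γ (φ s))) e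

variable (I) in
/-- `γ` has acceleration `A ∈ T_{γ̇(t)} TM` at `t`, where `A` is given by its components in the
preferred induced chart at `γ̇(t)`. -/
def HasAcceleration (γ : ℝ → M) (t : ℝ) (A : E × E) : Prop :=
  HasMFDerivAt 𝓘(ℝ, ℝ) I.tangent (velocity I γ) t
    ((1 : ℝ →L[ℝ] ℝ).smulRight A : ℝ →L[ℝ] E × E)

/-- The acceleration of `γ ∘ φ` is the image of `φ' A` under multiplication of velocities by `φ'`, plus
`φ''` times the velocity of `γ` seen as a vertical vector. -/
theorem HasAcceleration.comp {γ : ℝ → M} {φ : ℝ → ℝ} {J J' : Set ℝ}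
    (hγ : ∀ t ∈ J, velocity I γ t ∈ slit I M) (hφ : IsReparametrization φ J' J) {s : ℝ}
    (hs : s ∈ J') {A : E × E}
    (hA : HasAcceleration I γ (φ s) A) :
    HasAcceleration I (γ ∘ φ) s (deriv φ s • A.1,
      deriv φ s ^ 2 • A.2 + HSMul.hSMul (β := E) (deriv (deriv φ) s) (velocity I γ (φ s)).2) := by
  obtain ⟨hJ', -, hsm, -, himg⟩ := hφ
  have hc (r : ℝ) (hr : r ∈ J') : ContDiffAt ℝ 2 φ r :=
    (hsm.contDiffAt (hJ'.mem_nhds hr)).of_le ENat.LEInfty.out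
  have hd2 : HasDerivAt (deriv φ) (deriv (deriv φ) s) s := by
    refine DifferentiableAt.hasDerivAt ?_
    have h := ((hc s hs).fderiv_right (m := 1) (by norm_num)).differentiableAt (by simp)
    exact h.clm_apply (differentiableAt_const 1)
  have hV := HasMFDerivAt.comp s hA ((hc s hs).differentiableAt (by simp)).hasDerivAt.hasFDerivAt.hasMFDerivAt
  have h := hasMFDerivAt_fibreSmul hV hd2.hasFDerivAt.hasMFDerivAt
  have e : velocity I (γ ∘ φ) =ᶠ[nhds s]
      fun r ↦ fibreSmul I (deriv φ r) ((velocity I γ ∘ φ) r) := by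
    filter_upwards [hJ'.mem_nhds hs] with r hr
    exact velocity_comp (hγ _ (himg ▸ mem_image_of_mem φ hr))
      ((hc r hr).differentiableAt (by simp))
  refine (h.congr_of_eventuallyEq e).congr_mfderiv ?_
  refine ContinuousLinearMap.ext_ring (Prod.ext ?_ ?_)
  · change (1 : ℝ →L[ℝ] ℝ) (ContinuousLinearMap.toSpanSingleton ℝ (deriv φ s) (1 : ℝ)) • A.1 =
      (1 : ℝ →L[ℝ] ℝ) 1 • deriv φ s • A.1
    simp
  · let y : E := (velocity I γ (φ s)).2
    change deriv φ s • (1 : ℝ →L[ℝ] ℝ)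
        (ContinuousLinearMap.toSpanSingleton ℝ (deriv φ s) (1 : ℝ)) • A.2 +
        ContinuousLinearMap.toSpanSingleton ℝ (deriv (deriv φ) s) (1 : ℝ) • y =
      (1 : ℝ →L[ℝ] ℝ) 1 • (deriv φ s ^ 2 • A.2 + deriv (deriv φ) s • y)
    simp [pow_two, smul_smul]

theorem isReparametrization_id {J : Set ℝ} (h1 : IsOpen J) (h2 : J.OrdConnected) :
    IsReparametrization id J J :=
  ⟨h1, h2, contDiffOn_id, fun t _ ↦ by simp, image_id J⟩

theorem projectivelyEquivalent_of_sameCurves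
    {S : (v : TangentBundle I M) → TangentSpace I.tangent v} {𝓔 : TangentBundle I M → ℝ}
    (h : SameCurves (IsSprayGeodesic I S) (IsEnergyGeodesic I 𝓔)) :
    ProjectivelyEquivalent (IsSprayGeodesic I S) (IsEnergyGeodesic I 𝓔) :=
  ⟨fun γ J hγ ↦ ⟨id, J, isReparametrization_id hγ.1 hγ.2.1, (h γ J).1 hγ⟩,
    fun γ J hγ ↦ ⟨id, J, isReparametrization_id hγ.1 hγ.2.1, (h γ J).2 hγ⟩⟩

theorem HasAcceleration.unique {γ : ℝ → M} {t : ℝ} {A A' : E × E}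
    (h : HasAcceleration I γ t A)
    (h' : HasAcceleration I γ t A') : A = A' := by
  have e : ((1 : ℝ →L[ℝ] ℝ).smulRight A : ℝ →L[ℝ] E × E) = (1 : ℝ →L[ℝ] ℝ).smulRight A' := hasMFDerivAt_unique h h'
  simpa using congrArg (fun T : ℝ →L[ℝ] E × E ↦ T 1) e

/-- A `2`-homogeneous vector field whose geodesics agree with those of a positive energy `𝓔` up to
reparametrization has the same geodesics as `𝓔` as soon as `𝓔` is constant along it: the
accelerations differ by a multiple of the Liouville field, and the coefficient vanishes. -/
theorem sameCurves_of_projectivelyEquivalent [I.Boundaryless]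
    {S : (v : TangentBundle I M) → TangentSpace I.tangent v} {𝓔 : TangentBundle I M → ℝ}
    (hsmooth : ContMDiffOn I.tangent 𝓘(ℝ, ℝ) ∞ 𝓔 (slit I M))
    (hom : ∀ (c : ℝ) (v : TangentBundle I M), 0 < c → 𝓔 (fibreSmul I c v) = c ^ 2 * 𝓔 v)
    (hpos : ∀ v ∈ slit I M, 0 < 𝓔 v)
    (hS : ∀ (c : ℝ) (v : TangentBundle I M),
      (S (fibreSmul I c v) : E × E) = (c • (S v : E × E).1, c ^ 2 • (S v : E × E).2))
    (hint : ∀ v ∈ slit I M, mfderiv I.tangent 𝓘(ℝ, ℝ) 𝓔 v (S v) = 0)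
    (h : ProjectivelyEquivalent (IsSprayGeodesic I S) (IsEnergyGeodesic I 𝓔)) :
    SameCurves (IsSprayGeodesic I S) (IsEnergyGeodesic I 𝓔) := by
  -- The components of `S` in the preferred charts.
  let σ (v : TangentBundle I M) : E × E := S v
  have hσ (c : ℝ) (v : TangentBundle I M) :
      σ (fibreSmul I c v) = (c • (σ v).1, c ^ 2 • (σ v).2) := hS c v
  refine fun γ J ↦ ⟨fun hγ ↦ ?_, fun hγ ↦ ?_⟩
  · obtain ⟨φ, J', hφ, -, -, -, hE⟩ := h.1 γ J hγ
    obtain ⟨hJ, hJc, hslit, hcurve⟩ := hγ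
    refine ⟨hJ, hJc, hslit, fun t ht ↦ ?_⟩
    have hV := (hcurve t ht).hasMFDerivAt (hJ.mem_nhds ht)
    refine ⟨S (velocity I γ t), hV, fun B ↦ ?_⟩
    have hv := hslit t ht
    obtain ⟨s, hs, rfl⟩ : t ∈ φ '' J' := hφ.2.2.2.2 ▸ ht
    have hc : 0 < deriv φ s := hφ.2.2.2.1 s hs
    have hφs : DifferentiableAt ℝ φ s := differentiableAt_of_deriv_ne_zero hc.ne'
    obtain ⟨A, hA, hEL⟩ : ∃ A : E × E, HasAcceleration I (γ ∘ φ) s A ∧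
        ∀ B : E × E, eulerLagrangeForm I 𝓔 (velocity I (γ ∘ φ) s) A B = 0 := hE s hs
    have hAS := hA.unique (HasAcceleration.comp hslit hφ hs hV)
    have hw := velocity_comp hv hφs
    rw [hw] at hEL
    have hwslit : fibreSmul I (deriv φ s) (velocity I γ (φ s)) ∈ slit I M :=
      smul_ne_zero (M := E) hc.ne' hv
    generalize velocity I γ (φ s) = v at *
    let y : E := v.2
    have hAS' : A = σ (fibreSmul I (deriv φ s) v) +
        (deriv (deriv φ) s / deriv φ s) • ((0, (fibreSmul I (deriv φ s) v).2) : E × E) := by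
      rw [hAS, hσ]
      change ((deriv φ s • (σ v).1, deriv φ s ^ 2 • (σ v).2 + deriv (deriv φ) s • y) : E × E) =
        (deriv φ s • (σ v).1, deriv φ s ^ 2 • (σ v).2) + _ • (0, deriv φ s • y)
      refine Prod.ext ?_ ?_
      · simp
      · simp [smul_smul, div_mul_cancel₀ _ hc.ne']
    have hr := vertical_coeff_eq_zero hsmooth hom hwslit (hpos _ hwslit) (hint _ hwslit)
      hAS' (hEL A)
    rw [hr, zero_smul, add_zero, hσ] at hAS'
    have h1 := eulerLagrangeForm_fibreSmul hsmooth hom hc hv (σ v) B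
    rw [← hAS', hEL] at h1
    exact (mul_eq_zero.1 h1.symm).resolve_left (pow_pos hc 2).ne'
  · obtain ⟨φ, J', hφ, -, -, -, hS'⟩ := h.2 γ J hγ
    obtain ⟨hJ, hJc, hslit, hE⟩ := hγ
    refine ⟨hJ, hJc, hslit, fun t ht ↦ HasMFDerivAt.hasMFDerivWithinAt ?_⟩
    have hv := hslit t ht
    obtain ⟨A, hA, hEL⟩ : ∃ A : E × E, HasAcceleration I γ t A ∧
        ∀ B : E × E, eulerLagrangeForm I 𝓔 (velocity I γ t) A B = 0 := hE t ht
    obtain ⟨s, hs, rfl⟩ : t ∈ φ '' J' := hφ.2.2.2.2 ▸ ht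
    have hc : 0 < deriv φ s := hφ.2.2.2.1 s hs
    have hφs : DifferentiableAt ℝ φ s := differentiableAt_of_deriv_ne_zero hc.ne'
    have hV : HasAcceleration I (γ ∘ φ) s (σ (velocity I (γ ∘ φ) s)) :=
      (hS' s hs).hasMFDerivAt (hφ.1.mem_nhds hs)
    have hAS := hV.unique (HasAcceleration.comp hslit hφ hs hA)
    rw [velocity_comp hv hφs, hσ, Prod.mk.injEq] at hAS
    change HasAcceleration I γ (φ s) (σ (velocity I γ (φ s)))
    generalize velocity I γ (φ s) = v at *
    let y : E := v.2
    have hAS' : A = σ v +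
        (-(deriv (deriv φ) s / deriv φ s ^ 2)) • ((0, v.2) : E × E) := by
      have h2 : (σ v).2 = A.2 + (deriv (deriv φ) s / deriv φ s ^ 2) • y := by
        apply smul_right_injective E (pow_pos hc 2).ne'
        change _ • _ = _ • (_ + _)
        rw [smul_add, smul_smul, mul_div_cancel₀ _ (pow_pos hc 2).ne']
        exact hAS.2
      change A = σ v + _ • ((0, y) : E × E)
      refine Prod.ext ?_ ?_
      · simpa using (smul_right_injective E hc.ne' hAS.1).symm
      · simp [h2]
    have hr := vertical_coeff_eq_zero hsmooth hom hv (hpos _ hv) (hint _ hv) hAS' (hEL A)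
    rw [hr, zero_smul, add_zero] at hAS'
    rwa [← hAS']

end Geodesics

/-! ### The canonical spray and left invariant functions -/

section Group

variable {E : Type*} [NormedAddCommGroup E] [NormedSpace ℝ E]
  {H : Type*} [TopologicalSpace H] {I : ModelWithCorners ℝ E H}
  {G : Type*} [TopologicalSpace G] [ChartedSpace H G] [Group G] [LieGroup I ∞ G]

variable (I) in
/-- The left invariant vector field `g ↦ (λ_g)_* α`, as a map `G → TG`. -/
noncomputable def invariantField (α : GroupLieAlgebra I G) (g : G) : TangentBundle I G :=
  ⟨g, mulInvariantVectorField α g⟩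

theorem mdifferentiableAt_mul_left (a x : G) : MDifferentiableAt I I (fun h : G ↦ a * h) x :=
  (contMDiff_mul_left (I := I) (n := ∞) (a := a)).contMDiffAt.mdifferentiableAt (by simp)

theorem invariantField_maurerCartan (v : TangentBundle I G) :
    invariantField I (maurerCartan I v) v.1 = v := by
  obtain ⟨x, y⟩ := v
  have h := mfderiv_comp x (mdifferentiableAt_mul_left (I := I) x (x⁻¹ * x))
    (mdifferentiableAt_mul_left (I := I) x⁻¹ x)
  have e : (fun h : G ↦ x * h) ∘ (fun h : G ↦ x⁻¹ * h) = id := by ext; simp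
  rw [e, mfderiv_id] at h
  have h1 := congrArg (fun T : E →L[ℝ] E ↦ T y) h
  refine congrArg (TotalSpace.mk x) ?_
  have h2 (z : G) (hz : z = 1) (w : E) : (mfderiv I I (fun h : G ↦ x * h) z : E →L[ℝ] E) w =
      (mfderiv I I (fun h : G ↦ x * h) 1 : E →L[ℝ] E) w := by subst hz; rfl
  exact (h1.trans (h2 _ (inv_mul_cancel x) _)).symm

theorem hasMFDerivAt_invariantField (α : GroupLieAlgebra I G) (x : G) :
    HasMFDerivAt I I.tangent (invariantField I α) x
      (mfderiv I I.tangent (invariantField I α) x) := by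
  have : LieGroup I (minSmoothness ℝ 3) G := by
    rw [minSmoothness_of_isRCLikeNormedField]; infer_instance
  exact (mdifferentiableAt_mulInvariantVectorField α).hasMFDerivAt

theorem canonicalSpray_eq (v : TangentBundle I G) :
    canonicalSpray I v = mfderiv I I.tangent (invariantField I (maurerCartan I v)) v.1 v.2 := rfl

/-- The canonical spray is a second order vector field: `J S = C`. -/
theorem canonicalSpray_fst (v : TangentBundle I G) : (canonicalSpray I v : E × E).1 = v.2 := by
  have h1 := hasMFDerivAt_invariantField (maurerCartan I v) v.1
  have h2 := (hasMFDerivAt_proj _).comp v.1 h1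
  have e := hasMFDerivAt_unique h2 (hasMFDerivAt_id v.1)
  exact congrArg (fun T : E →L[ℝ] E ↦ T v.2) e

omit [LieGroup I ∞ G] in
theorem maurerCartan_fibreSmul (c : ℝ) (v : TangentBundle I G) :
    maurerCartan I (fibreSmul I c v) = c • maurerCartan I v :=
  (mfderiv I I (fun h : G ↦ v.1⁻¹ * h) v.1).map_smul c v.2

omit [LieGroup I ∞ G] in
theorem invariantField_smul (c : ℝ) (α : GroupLieAlgebra I G) :
    invariantField I (c • α) = fun g ↦ fibreSmul I c (invariantField I α g) := by
  ext1 g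
  exact congrArg (TotalSpace.mk g) ((mfderiv I I (fun h : G ↦ g * h) 1).map_smul c α)

/-- The canonical spray is homogeneous of degree `2`: at `c v` it is `c (h_c)_* S_v`. -/
theorem canonicalSpray_fibreSmul (c : ℝ) (v : TangentBundle I G) :
    (canonicalSpray I (fibreSmul I c v) : E × E) =
      (c • (canonicalSpray I v : E × E).1, c ^ 2 • (canonicalSpray I v : E × E).2) := by
  have h1 := hasMFDerivAt_invariantField (maurerCartan I v) v.1
  have h2 := (hasMFDerivAt_fibreSmul h1 (hasMFDerivAt_const c v.1)).mfderiv
  rw [← invariantField_smul, ← maurerCartan_fibreSmul] at h2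
  rw [canonicalSpray_eq]
  let D : E →L[ℝ] E × E := mfderiv I I.tangent (invariantField I (maurerCartan I v)) v.1
  let y : E := v.2
  let z : E := (invariantField I (maurerCartan I v) v.1).2
  have h3 := congrArg (fun T : E →L[ℝ] E × E ↦ T (c • y)) h2
  refine h3.trans (Prod.ext ?_ ?_)
  · change (D (c • y)).1 = c • (D y).1
    simp
  · change c • (D (c • y)).2 + (0 : ℝ) • z = c ^ 2 • (D y).2
    rw [zero_smul]
    simp [pow_two, smul_smul]

omit [LieGroup I ∞ G] in
theorem LeftInvariant.apply_invariantField {L : TangentBundle I G → ℝ} (hL : LeftInvariant I L)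
    (α : GroupLieAlgebra I G) (g : G) : L (invariantField I α g) = L ⟨1, α⟩ := by
  have h := hL g ⟨1, α⟩
  have e : tangentMap I I (fun h : G ↦ g * h) ⟨1, α⟩ = invariantField I α g := by
    have (g' : G) (hg : g' = g) (y : E) (hy : y = mulInvariantVectorField α g) :
      (⟨g', y⟩ : TangentBundle I G) = invariantField I α g := by subst hg; subst hy; rfl
    exact this _ (mul_one g) _ rfl
  rw [← e, h]

/-- `S_v` is tangent to the left invariant field through `v`, along which a left invariant function is
constant. -/
theorem LeftInvariant.mfderiv_canonicalSpray {L : TangentBundle I G → ℝ}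
    (hL : LeftInvariant I L) (hsmooth : ContMDiffOn I.tangent 𝓘(ℝ, ℝ) ∞ L (slit I G))
    {v : TangentBundle I G} (hv : v ∈ slit I G) :
    mfderiv I.tangent 𝓘(ℝ, ℝ) L v (canonicalSpray I v) = 0 := by
  have hd : HasMFDerivAt I.tangent 𝓘(ℝ, ℝ) L v (mfderiv I.tangent 𝓘(ℝ, ℝ) L v) :=
    ((hsmooth.contMDiffAt (slit_mem_nhds hv)).mdifferentiableAt (by simp)).hasMFDerivAt
  have h1 := hasMFDerivAt_invariantField (maurerCartan I v) v.1
  have hx := invariantField_maurerCartan v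
  rw [← hx] at hd
  have h2 := HasMFDerivAt.comp v.1 hd h1
  have e : L ∘ invariantField I (maurerCartan I v) = fun _ ↦ L ⟨1, maurerCartan I v⟩ :=
    funext fun g ↦ hL.apply_invariantField _ g
  rw [e] at h2
  have h3 := hasMFDerivAt_unique h2 (hasMFDerivAt_const _ _)
  have h4 := congrArg (fun T : E →L[ℝ] ℝ ↦ T v.2) h3
  rw [hx] at h4
  exact h4

theorem satisfiesEulerLagrange_sq_div_two [I.Boundaryless] {F : TangentBundle I G → ℝ}
    (hsmooth : ContMDiffOn I.tangent 𝓘(ℝ, ℝ) ∞ F (slit I G)) (hF : LeftInvariant I F)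
    (h : SatisfiesEulerLagrange I (canonicalSpray I (G := G)) F) :
    SatisfiesEulerLagrange I (canonicalSpray I (G := G)) (fun v ↦ F v ^ 2 / 2) := by
  intro v hv B
  have h1 : fderiv ℝ (F ∘ (extChartAt I.tangent v).symm) (extChartAt I.tangent v v)
      (canonicalSpray I v) = 0 :=
    (mfderiv_apply_eq_fderiv hsmooth hv _).symm.trans (hF.mfderiv_canonicalSpray hsmooth hv)
  have h2 : (canonicalSpray I v : E × E).1 = (extChartAt I.tangent v v).2 :=
    (canonicalSpray_fst v).trans (extChartAt_self_snd v).symm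
  have h3 := eulerLagrangeLocal_sq_div_two (contDiffAt_comp_extChartAt_symm hsmooth hv) h2 h1 B
  refine h3.trans (mul_eq_zero_of_right _ (h v hv B))

theorem projectivelyEquivalent_iff_sameCurves [I.Boundaryless] {𝓔 : TangentBundle I G → ℝ}
    (hsmooth : ContMDiffOn I.tangent 𝓘(ℝ, ℝ) ∞ 𝓔 (slit I G))
    (hom : ∀ (c : ℝ) (v : TangentBundle I G), 0 < c → 𝓔 (fibreSmul I c v) = c ^ 2 * 𝓔 v)
    (hpos : ∀ v ∈ slit I G, 0 < 𝓔 v) (hinv : LeftInvariant I 𝓔) :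
    ProjectivelyEquivalent (IsSprayGeodesic I (canonicalSpray I (G := G))) (IsEnergyGeodesic I 𝓔) ↔
      SameCurves (IsSprayGeodesic I (canonicalSpray I (G := G))) (IsEnergyGeodesic I 𝓔) :=
  ⟨sameCurves_of_projectivelyEquivalent hsmooth hom hpos canonicalSpray_fibreSmul
    fun _ hv ↦ hinv.mfderiv_canonicalSpray hsmooth hv, projectivelyEquivalent_of_sameCurves⟩

end Group

/-! ### Smoothness of the energy of a Riemannian metric -/

section Energies

variable {E : Type*} [NormedAddCommGroup E] [NormedSpace ℝ E]
  {H : Type*} [TopologicalSpace H] {I : ModelWithCorners ℝ E H}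
  {M : Type*} [TopologicalSpace M] [ChartedSpace H M] [IsManifold I ∞ M]

/-- Smoothness of `v ↦ g (v, v) / 2`, from applying the metric tensor to the tautological section
of the pullback of `TM` to `TM`. -/
theorem contMDiff_riemannEnergy
    (g : ContMDiffRiemannianMetric I ∞ E (fun x : M ↦ TangentSpace I x)) :
    ContMDiff I.tangent 𝓘(ℝ, ℝ) ∞ (riemannEnergy I g) := by
  have hid : ContMDiff I.tangent I.tangent ∞
      (fun v : TangentBundle I M ↦ TotalSpace.mk' E v.1 v.2) := contMDiff_id
  have h : ContMDiff I.tangent (I.prod 𝓘(ℝ)) ∞ (fun v : TangentBundle I M ↦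
      TotalSpace.mk' ℝ (E := Bundle.Trivial M ℝ) v.1 (g.inner v.1 v.2 v.2)) :=
    (g.contMDiff.comp (contMDiff_proj (IB := I) (TangentSpace I))).clm_bundle_apply₂
      (F₁ := E) (F₂ := E) hid hid
  have h2 : ContMDiff I.tangent 𝓘(ℝ, ℝ) ∞
      (fun v : TangentBundle I M ↦ g.inner v.1 v.2 v.2) := by
    intro v
    exact (contMDiffAt_totalSpace.1 (h v)).2
  exact h2.div_const 2

end Energies

end LieSpray

theorem proposition4p4
    {E : Type*} [NormedAddCommGroup E] [NormedSpace ℝ E] [FiniteDimensional ℝ E]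
    {H : Type*} [TopologicalSpace H] (I : ModelWithCorners ℝ E H) [I.Boundaryless]
    {G : Type*} [TopologicalSpace G] [ChartedSpace H G] [Group G] [LieGroup I ∞ G] :
    (LieSpray.LeftInvProjRiemannMetrizable I (LieSpray.canonicalSpray I (G := G)) ↔
      LieSpray.LeftInvRiemannMetrizable I (LieSpray.canonicalSpray I (G := G))) ∧
    (LieSpray.LeftInvProjFinslerMetrizable I (LieSpray.canonicalSpray I (G := G)) ↔
      LieSpray.LeftInvFinslerMetrizable I (LieSpray.canonicalSpray I (G := G))) ∧
    (∀ L : TangentBundle I G → ℝ, ContMDiffOn I.tangent 𝓘(ℝ, ℝ) ∞ L (LieSpray.slit I G) →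
      LieSpray.LeftInvariant I L →
        ∀ v ∈ LieSpray.slit I G,
          mfderiv I.tangent 𝓘(ℝ, ℝ) L v (LieSpray.canonicalSpray I v) = 0) ∧
    (∀ F : TangentBundle I G → ℝ, ContMDiffOn I.tangent 𝓘(ℝ, ℝ) ∞ F (LieSpray.slit I G) →
      LieSpray.LeftInvariant I F →
        LieSpray.SatisfiesEulerLagrange I (LieSpray.canonicalSpray I (G := G)) F →
          LieSpray.SatisfiesEulerLagrange I (LieSpray.canonicalSpray I (G := G))
            (fun v ↦ F v ^ 2 / 2)) := by
  refine ⟨exists_congr fun g ↦ and_congr_right fun hg ↦ ?_,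
    exists_congr fun F ↦ and_congr_right fun hF ↦ and_congr_right fun hinv ↦ ?_,
    fun L hL hinv v hv ↦ hinv.mfderiv_canonicalSpray hL hv,
    fun F hF hinv h ↦ LieSpray.satisfiesEulerLagrange_sq_div_two hF hinv h⟩
  · refine LieSpray.projectivelyEquivalent_iff_sameCurves (LieSpray.contMDiff_riemannEnergy g).contMDiffOn
      (fun c v _ ↦ ?_) (fun v hv ↦ half_pos (g.pos v.1 v.2 hv)) fun a v ↦ ?_
    · change g.inner v.1 (c • v.2) (c • v.2) / 2 = c ^ 2 * (g.inner v.1 v.2 v.2 / 2)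
      rw [map_smul, map_smul]
      simp only [smul_apply, smul_eq_mul]
      ring
    · exact congrArg (· / 2) (hg a v.1 v.2 v.2)
  · refine LieSpray.projectivelyEquivalent_iff_sameCurves ((hF.smooth.pow 2).div_const 2)
      (fun c v hc ↦ ?_) (fun v hv ↦ half_pos (pow_pos (hF.pos v hv) 2)) fun a v ↦ ?_
    · change F ⟨v.1, c • v.2⟩ ^ 2 / 2 = c ^ 2 * (F v ^ 2 / 2)
      rw [hF.homogeneous v.1 v.2 c hc.le]
      ring
    · exact congrArg (· ^ 2 / 2) (hinv a v)
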